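/- Let $d\ge 0$. For a finitely supported sequence (mask) $A:\mathbb Z\to\mathbb R^{(d+1)\times(d+1)}$ let $S_A$ be the subdivision operator $(S_Ac)(\alpha)=\sum_{\beta\in\mathbb Z}A(\alpha-2\beta)\,c(\beta)$ on sequences $c:\mathbb Z\to\mathbb R^{d+1}$, and let $A^*(z)=\sum_{\alpha\in\mathbb Z}A(\alpha)z^\alpha$, $z\in\mathbb C\setminus\{0\}$, be its symbol. Put $D=\operatorname{diag}(1,\tfrac12,\dots,2^{-d})$. The Hermite subdivision scheme $H_A$ generates from initial data $f_0:\mathbb Z\to\mathbb R^{d+1}$ the refinements $f_n=[f_n^{(0)},\dots,f_n^{(d)}]^T$ given by $f_{n+1}(\alpha)=\sum_{\beta}D^{-n-1}A(\alpha-2\beta)D^n f_n(\beta)$, $n\ge 0$. It is called $C^d$-convergent if for every $f_0:\mathbb Z\to\mathbb R^{d+1}$ there is a continuous $\Phi=[\phi_0,\dots,\phi_d]^T:\mathbb R\to\mathbb R^{d+1}$ with $\phi_0\in C^d(\mathbb R)$ and $\phi_0^{(i)}=\phi_i$ for $0\le i\le d$, such that for every compact $K\subset\mathbb R$ there is a sequence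 $\varepsilon_n\to 0$ with $$\max_{0\le i\le d}\ \max_{\alpha\in\mathbb Z\cap 2^nK}\bigl|f_n^{(i)}(\alpha)-\phi_i(2^{-n}\alpha)\bigr|\le\varepsilon_n ,\qquad n\ge 0.$$ A generalized complete Taylor operator is an operator $\widetilde T_d=\Delta I+[t_{jk}]_{j,k=0,\dots,d}$ on sequences $\mathbb Z\to\mathbb R^{d+1}$, where $\Delta c=c(\cdot+1)-c$, and where the $t_{jk}\in\mathbb R$ satisfy $t_{jk}=0$ for $k\le j$ and $t_{j,j+1}=-1$. The operator $S_{\widetilde B}$ is called contractive if $\|S_{\widetilde B}^N\|<1$ for some $N\ge 1$, in the operator norm on bounded sequences $\mathbb Z\to\mathbb R^{d+1}$ with the supremum norm. **Corollary.** Let $A,\widetilde B:\mathbb Z\to\mathbb R^{(d+1)\times(d+1)}$ be two finitely supported masks related by the factorization $\widetilde T_dS_A=2^{-d}S_{\widetilde B}\widetilde T_d$ for some generalized complete Taylor operator $\widetilde T_d$. Suppose that for any initial data $f_0:\mathbb Z\to\mathbb R^{d+1}$ with associated refinements $f_n$ of the Hermite scheme $H_A$, the sequence $f_n(0)$ converges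 to a limit in $\mathbb R^{d+1}$ as $n\to\infty$. Write $$\widetilde B^*(z)=\begin{bmatrix}\widetilde B_{11}^*(z)&\widetilde B_{12}^*(z)\\ \widetilde B_{21}^*(z)&\widetilde B_{22}^*(z)\end{bmatrix}$$ with blocks $\widetilde B_{11}^*(z)$ of size $d\times d$ and $\widetilde B_{22}^*(z)$ of size $1\times1$. If $S_{\widetilde B}$ is contractive, $\widetilde B_{21}^*(1)=0$ and $\widetilde B_{22}^*(1)=1$, then $H_A$ is $C^d$-convergent. -/

import Mathlib

open Filter Topology
open scoped Matrix

namespace HermiteSubdivision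

/-- Bi-infinite vector sequences, the space `ℓ(ℤ, ℝ^(d+1))`; the values carry the sup norm. -/
abbrev VecSeq (d : ℕ) : Type := ℤ → (Fin (d + 1) → ℝ)

/-- Sequences of `(d+1) × (d+1)` matrices.  Such a sequence is a mask if it is finitely supported;
this is assumed explicitly where it is needed. -/
abbrev MatSeq (d : ℕ) : Type := ℤ → Matrix (Fin (d + 1)) (Fin (d + 1)) ℝ

/-- The subdivision operator `(S_A c)(α) = ∑_β A(α - 2β) c(β)`
(a finite sum when `A` is finitely supported). -/
noncomputable def subdivOp {d : ℕ} (A : MatSeq d) (c : VecSeq d) : VecSeq d :=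
  fun α => ∑ᶠ β : ℤ, A (α - 2 * β) *ᵥ c β

/-- The symbol `A^*(z) = ∑_α A(α) z^α`, `z ∈ ℂ \ {0}`, of a finitely supported `A`. -/
noncomputable def symbol {d : ℕ} (A : MatSeq d) (z : ℂ) : Matrix (Fin (d + 1)) (Fin (d + 1)) ℂ :=
  ∑ᶠ α : ℤ, z ^ α • (A α).map Complex.ofReal

/-- The diagonal matrix `D = diag(1, 1/2, …, 1/2^d)`. -/
noncomputable def scaleMatrix (d : ℕ) : Matrix (Fin (d + 1)) (Fin (d + 1)) ℝ :=
  Matrix.diagonal fun k => (1 / 2 : ℝ) ^ (k : ℕ)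

/-- The level-dependent mask `A_n(α) = D^(-n-1) A(α) D^n` of the Hermite scheme. -/
noncomputable def hermiteMask {d : ℕ} (A : MatSeq d) (n : ℕ) : MatSeq d :=
  fun α => (scaleMatrix d)⁻¹ ^ (n + 1) * A α * scaleMatrix d ^ n

/-- The refinements `f_n` of the initial data `f₀` under the Hermite scheme `H_A`. -/
noncomputable def hermiteRefine {d : ℕ} (A : MatSeq d) (f₀ : VecSeq d) : ℕ → VecSeq d
  | 0 => f₀
  | n + 1 => subdivOp (hermiteMask A n) (hermiteRefine A f₀ n)

/-- `C^p`-convergence, `p ≥ d`, of the Hermite scheme `H_A`. The condition `α ∈ 2^n K` is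
written `α / 2^n ∈ K`. -/
def IsHermiteConvergent {d : ℕ} (A : MatSeq d) (p : ℕ) : Prop :=
  d ≤ p ∧ ∀ f₀ : VecSeq d, ∃ φ : ℝ → (Fin (d + 1) → ℝ),
    Continuous φ ∧
    (∀ K : Set ℝ, IsCompact K → ∃ ε : ℕ → ℝ, Tendsto ε atTop (𝓝 0) ∧
      ∀ (n : ℕ) (i : Fin (d + 1)) (α : ℤ), (α : ℝ) / 2 ^ n ∈ K →
        |hermiteRefine A f₀ n α i - φ ((α : ℝ) / 2 ^ n) i| ≤ ε n) ∧
    ContDiff ℝ p (fun x => φ x 0) ∧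
    ∀ (i : Fin (d + 1)) (x : ℝ), iteratedDeriv (i : ℕ) (fun y => φ y 0) x = φ x i

/-- `T` is a generalized complete Taylor operator: `T = Δ I + [t_jk]` with a constant real matrix
`t` that is strictly upper triangular and has `-1` on the first superdiagonal, the remaining
entries above the superdiagonal being arbitrary. -/
def IsCompleteTaylorOp {d : ℕ} (T : VecSeq d → VecSeq d) : Prop :=
  ∃ t : Matrix (Fin (d + 1)) (Fin (d + 1)) ℝ,
    (∀ j k : Fin (d + 1), k ≤ j → t j k = 0) ∧
    (∀ j k : Fin (d + 1), (k : ℕ) = (j : ℕ) + 1 → t j k = -1) ∧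
    ∀ (f : VecSeq d) (α : ℤ), T f α = fwdDiff 1 f α + t *ᵥ f α

/-- `S_B` is contractive: some power `S_B^N` has norm less than one as an operator on the
bounded sequences with the supremum norm. -/
def IsContractive {d : ℕ} (B : MatSeq d) : Prop :=
  ∃ N : ℕ, 1 ≤ N ∧ ∃ ρ : ℝ, ρ < 1 ∧ ∀ (c : VecSeq d) (M : ℝ),
    (∀ β : ℤ, ‖c β‖ ≤ M) → ∀ α : ℤ, ‖(subdivOp B)^[N] c α‖ ≤ ρ * M

end HermiteSubdivision

open HermiteSubdivision

namespace HermiteSubdivision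

/-! Undoing the diagonal scaling gives f_n^(i) = 2^(ni) (S_A^n f₀)^(i), and iterating the
factorization gives 2^(nd) T S_A^n f₀ = S_B^n T f₀. By contractivity the right side decays
geometrically on every window |α| ≤ Q 2^n (`IsContractive.exists_geometric`).

The last row of T is Δ, so this decay controls the differences of f_n^(d) within a level. The symbol
conditions say that the last row of B^*(z) - zI vanishes at z = 1, hence has a finitely supported
antidifference C. Therefore f_{n+1}^(d)(α) - f_n^(d)(⌊α/2⌋) is the last component of S_C S_B^n T f₀
(`exists_last_component_factorization`) and decays too; together the two estimates give a continuous
limit of f_n^(d).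

Row j < d of T says that 2^n Δf_n^(j) - f_n^(j+1) equals 2^(n(j+1-d)) (S_B^n T f₀)^(j) minus the sum
over k ≥ j+2 of t_jk 2^(-n(k-j-1)) f_n^(k). This tends to zero once the components above j converge
(`tendstoOnGrid_divided_difference`). The limit of f_n(0) fixes the constant of integration, so
downward induction with `TendstoOnGrid.of_hasDerivAt` yields each φ_j as an antiderivative of
φ_{j+1}. -/

variable {d : ℕ}

/-! ### Convergence on dyadic grids -/

/-- `u n` approximates the samples of `φ` on the grid `2⁻ⁿ ℤ`, locally uniformly. -/
def TendstoOnGrid (u : ℕ → ℤ → ℝ) (φ : ℝ → ℝ) : Prop :=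
  ∀ (Q : ℕ) (ε : ℝ), 0 < ε → ∀ᶠ n : ℕ in atTop, ∀ α : ℤ, |α| ≤ Q * 2 ^ n →
    |u n α - φ ((α : ℝ) / 2 ^ n)| ≤ ε

theorem abs_div_two_pow_le {α : ℤ} {Q n : ℕ} (h : |α| ≤ Q * 2 ^ n) :
    |(α : ℝ) / 2 ^ n| ≤ Q := by
  rw [abs_div, abs_of_pos (by positivity : (0 : ℝ) < 2 ^ n), div_le_iff₀ (by positivity)]
  exact_mod_cast h

theorem TendstoOnGrid.add {u v : ℕ → ℤ → ℝ} (hu : TendstoOnGrid u 0) (hv : TendstoOnGrid v 0) :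
    TendstoOnGrid (fun n α => u n α + v n α) 0 := by
  intro Q ε hε
  filter_upwards [hu Q (ε / 2) (by linarith), hv Q (ε / 2) (by linarith)] with n h1 h2 α hα
  have h1 := h1 α hα
  have h2 := h2 α hα
  simp only [Pi.zero_apply, sub_zero] at h1 h2 ⊢
  linarith [abs_add_le (u n α) (v n α)]

theorem tendstoOnGrid_zero : TendstoOnGrid (fun _ _ => 0) 0 := by
  intro Q ε hε
  simp [hε.le]

theorem TendstoOnGrid.sum {ι : Type*} (s : Finset ι) {u : ι → ℕ → ℤ → ℝ}
    (h : ∀ i ∈ s, TendstoOnGrid (u i) 0) :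
    TendstoOnGrid (fun n α => ∑ i ∈ s, u i n α) 0 := by
  classical
  induction s using Finset.induction_on with
  | empty => simpa using tendstoOnGrid_zero
  | insert a s ha ih =>
    simp only [Finset.sum_insert ha]
    exact (h a (by simp)).add (ih fun i hi => h i (by simp [hi]))

theorem exists_bound_of_continuous {φ : ℝ → ℝ} (hφ : Continuous φ) (Q : ℝ) :
    ∃ M : ℝ, 0 ≤ M ∧ ∀ x, |x| ≤ Q → |φ x| ≤ M := by
  obtain ⟨M, hM⟩ := (isCompact_Icc (a := -Q) (b := Q)).exists_bound_of_continuousOn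
    hφ.continuousOn
  exact ⟨max M 0, le_max_right _ _, fun x hx => (hM x (abs_le.1 hx)).trans (le_max_left _ _)⟩

theorem TendstoOnGrid.smul_zero {u : ℕ → ℤ → ℝ} {φ : ℝ → ℝ} (hu : TendstoOnGrid u φ)
    (hφ : Continuous φ) {a : ℕ → ℝ} (ha : Tendsto a atTop (𝓝 0)) :
    TendstoOnGrid (fun n α => a n * u n α) 0 := by
  intro Q ε hε
  obtain ⟨M, hM0, hM⟩ := exists_bound_of_continuous hφ Q
  have ha' : ∀ᶠ n in atTop, |a n| < ε / (M + 1) := by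
    have := ha.abs
    rw [abs_zero] at this
    exact this.eventually (gt_mem_nhds (by positivity))
  filter_upwards [hu Q 1 one_pos, ha'] with n h1 h2 α hα
  have h3 := h1 α hα
  have h4 := hM _ (abs_div_two_pow_le hα)
  have h5 : |u n α| ≤ M + 1 := by
    have := abs_sub_abs_le_abs_sub (u n α) (φ ((α : ℝ) / 2 ^ n))
    linarith
  simp only [Pi.zero_apply, sub_zero, abs_mul]
  calc |a n| * |u n α| ≤ ε / (M + 1) * (M + 1) := by gcongr
    _ = ε := by field_simp

theorem tendstoOnGrid_zero_of_geometric {u : ℕ → ℤ → ℝ} {r : ℝ} (h0 : 0 ≤ r) (h1 : r < 1)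
    (hu : ∀ Q : ℕ, ∃ C : ℝ, ∀ (n : ℕ) (α : ℤ), |α| ≤ Q * 2 ^ n → |u n α| ≤ C * r ^ n) :
    TendstoOnGrid u 0 := by
  intro Q ε hε
  obtain ⟨C, hC⟩ := hu Q
  have : Tendsto (fun n => C * r ^ n) atTop (𝓝 0) := by
    simpa using (tendsto_pow_atTop_nhds_zero_of_lt_one h0 h1).const_mul C
  filter_upwards [this.eventually (gt_mem_nhds hε)] with n hn α hα
  simpa using (hC n α hα).trans hn.le

/-- The window grows from Q to Q + 1 because the floor may drop below -Q 2^n. -/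
theorem abs_floor_le {x : ℝ} {Q n : ℕ} (hx : |x| ≤ Q) :
    |⌊2 ^ n * x⌋| ≤ ((Q + 1 : ℕ) : ℤ) * 2 ^ n := by
  obtain ⟨h1, h2⟩ := abs_le.1 hx
  have hp : (1 : ℤ) ≤ 2 ^ n := one_le_pow₀ (by norm_num)
  have hq : (0 : ℝ) < 2 ^ n := by positivity
  rw [abs_le]
  constructor
  · rw [Int.le_floor]
    push_cast
    nlinarith
  · have : ⌊2 ^ n * x⌋ ≤ (Q : ℤ) * 2 ^ n := by
      have := Int.floor_le ((2 : ℝ) ^ n * x)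
      have h : ((⌊2 ^ n * x⌋ : ℤ) : ℝ) ≤ ((Q * 2 ^ n : ℤ) : ℝ) := by push_cast; nlinarith
      exact_mod_cast h
    push_cast
    linarith

/-- Geometric decay of the differences across levels and inside a level implies convergence to a
continuous limit. -/
theorem exists_continuous_tendstoOnGrid {u : ℕ → ℤ → ℝ} {r : ℝ} (h0 : 0 ≤ r) (h1 : r < 1)
    (hlevel : ∀ Q : ℕ, ∃ C : ℝ, ∀ (n : ℕ) (α : ℤ), |α| ≤ Q * 2 ^ (n + 1) →
      |u (n + 1) α - u n (α / 2)| ≤ C * r ^ n)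
    (hdiff : ∀ Q : ℕ, ∃ C : ℝ, ∀ (n : ℕ) (α : ℤ), |α| ≤ Q * 2 ^ n →
      |u n (α + 1) - u n α| ≤ C * r ^ n) :
    ∃ φ : ℝ → ℝ, Continuous φ ∧ TendstoOnGrid u φ := by
  -- Halving the index of the cell containing x gives its parent cell, so `hlevel` compares
  -- consecutive samples along the dyadic cells around x.
  have hfloor : ∀ (n : ℕ) (x : ℝ), ⌊2 ^ (n + 1) * x⌋ / 2 = ⌊2 ^ n * x⌋ := by
    intro n x
    have := Int.floor_div_natCast ((2 : ℝ) ^ (n + 1) * x) 2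
    rw [Nat.cast_ofNat] at this
    rw [← Nat.cast_ofNat (R := ℤ), ← this]
    congr 1
    ring
  have hstep : ∀ Q : ℕ, ∃ C : ℝ, ∀ x : ℝ, |x| ≤ Q → ∀ n : ℕ,
      dist (u n ⌊2 ^ n * x⌋) (u (n + 1) ⌊2 ^ (n + 1) * x⌋) ≤ C * r ^ n := by
    intro Q
    obtain ⟨C, hC⟩ := hlevel (Q + 1)
    refine ⟨C, fun x hx n => ?_⟩
    rw [dist_comm, Real.dist_eq, ← hfloor n x]
    exact hC n _ (abs_floor_le hx)
  have hlim : ∀ x : ℝ, ∃ y, Tendsto (fun n => u n ⌊2 ^ n * x⌋) atTop (𝓝 y) := by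
    intro x
    obtain ⟨Q, hQ⟩ := exists_nat_ge |x|
    obtain ⟨C, hC⟩ := hstep Q
    exact cauchySeq_tendsto_of_complete (cauchySeq_of_le_geometric r C h1 (hC x hQ))
  choose φ hφ using hlim
  have happrox : ∀ Q : ℕ, ∃ C : ℝ, ∀ x : ℝ, |x| ≤ Q → ∀ n : ℕ,
      |u n ⌊2 ^ n * x⌋ - φ x| ≤ C * r ^ n := by
    intro Q
    obtain ⟨C, hC⟩ := hstep Q
    refine ⟨C / (1 - r), fun x hx n => ?_⟩
    rw [← Real.dist_eq]
    refine (dist_le_of_le_geometric_of_tendsto r C h1 (hC x hx) (hφ x) n).trans_eq ?_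
    ring
  refine ⟨φ, ?_, ?_⟩
  · rw [continuous_iff_continuousAt]
    intro x
    obtain ⟨Q, hQ⟩ := exists_nat_ge |x|
    obtain ⟨C, hC⟩ := happrox (Q + 1)
    obtain ⟨C', hC'⟩ := hdiff (Q + 1 + 1)
    rw [Metric.continuousAt_iff]
    intro ε hε
    have hsmall : Tendsto (fun n => (C + C + C') * r ^ n) atTop (𝓝 0) := by
      simpa using (tendsto_pow_atTop_nhds_zero_of_lt_one h0 h1).const_mul (C + C + C')
    obtain ⟨n, hn⟩ := (hsmall.eventually (gt_mem_nhds hε)).exists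
    have hp : (0 : ℝ) < 2 ^ n := by positivity
    have hp1 : (1 : ℝ) ≤ 2 ^ n := one_le_pow₀ (by norm_num)
    -- At distance below 2^(-n) the two floors differ by at most one, so a single within-level
    -- difference links the samples at x and y.
    refine ⟨1 / 2 ^ n, by positivity, fun {y} hy => lt_of_le_of_lt ?_ hn⟩
    rw [Real.dist_eq] at hy ⊢
    have hxQ : |x| ≤ (Q + 1 : ℕ) := by push_cast; linarith
    have hyQ : |y| ≤ (Q + 1 : ℕ) := by
      have h2 := abs_sub_abs_le_abs_sub y x
      have h3 : 1 / (2 : ℝ) ^ n ≤ 1 := by rw [div_le_one hp]; exact hp1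
      push_cast
      linarith
    have hfl : |u n ⌊2 ^ n * y⌋ - u n ⌊2 ^ n * x⌋| ≤ C' * r ^ n := by
      rw [lt_div_iff₀ hp] at hy
      have hxy : |(y - x) * 2 ^ n| < 1 := by rwa [abs_mul, abs_of_pos hp]
      rw [abs_lt] at hxy
      have a1 := Int.floor_le ((2 : ℝ) ^ n * x)
      have a2 := Int.lt_floor_add_one ((2 : ℝ) ^ n * x)
      have b1 := Int.floor_le ((2 : ℝ) ^ n * y)
      have b2 := Int.lt_floor_add_one ((2 : ℝ) ^ n * y)
      have e1 : ⌊2 ^ n * y⌋ < ⌊2 ^ n * x⌋ + 2 := by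
        have : (⌊2 ^ n * y⌋ : ℝ) < ⌊2 ^ n * x⌋ + 2 := by linarith
        exact_mod_cast this
      have e2 : ⌊2 ^ n * x⌋ < ⌊2 ^ n * y⌋ + 2 := by
        have : (⌊2 ^ n * x⌋ : ℝ) < ⌊2 ^ n * y⌋ + 2 := by linarith
        exact_mod_cast this
      have kx := hC' n _ (abs_floor_le (n := n) hxQ)
      have ky := hC' n _ (abs_floor_le (n := n) hyQ)
      have hcase : ⌊2 ^ n * y⌋ = ⌊2 ^ n * x⌋ + 1 ∨ ⌊2 ^ n * y⌋ = ⌊2 ^ n * x⌋ ∨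
        ⌊2 ^ n * x⌋ = ⌊2 ^ n * y⌋ + 1 := by omega
      rcases hcase with h | h | h
      · rw [h]; exact kx
      · rw [h, sub_self, abs_zero]; exact (abs_nonneg _).trans kx
      · rw [h, abs_sub_comm]; exact ky
    have hx' := abs_le.1 (hC x hxQ n)
    have hy' := abs_le.1 (hC y hyQ n)
    have hf' := abs_le.1 hfl
    rw [abs_le]
    constructor <;> linarith
  · intro Q ε hε
    obtain ⟨C, hC⟩ := happrox Q
    have hsmall : Tendsto (fun n => C * r ^ n) atTop (𝓝 0) := by
      simpa using (tendsto_pow_atTop_nhds_zero_of_lt_one h0 h1).const_mul C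
    filter_upwards [hsmall.eventually (gt_mem_nhds hε)] with n hn α hα
    have := hC _ (abs_div_two_pow_le hα) n
    -- At a grid point of level n the floor is the index itself.
    rw [mul_div_cancel₀ _ (by positivity), Int.floor_intCast] at this
    exact this.trans hn.le

/-- A sequence is bounded by its value at zero and its differences. -/
theorem abs_le_of_diff_le {w : ℤ → ℝ} {δ : ℝ} {M : ℤ} (h : ∀ α, |α| ≤ M → |w (α + 1) - w α| ≤ δ)
    {α : ℤ} (hα : |α| ≤ M) : |w α| ≤ |w 0| + |(α : ℝ)| * δ := by
  have key : ∀ k : ℕ, (k : ℤ) ≤ M →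
      |w k| ≤ |w 0| + k * δ ∧ |w (-k)| ≤ |w 0| + k * δ := by
    intro k
    induction k with
    | zero => simp
    | succ k ih =>
      intro hk
      push_cast at hk ⊢
      obtain ⟨i1, i2⟩ := ih (by omega)
      have h1 := h k (by rw [abs_of_nonneg (by positivity)]; omega)
      have h2 := h (-(k + 1)) (by rw [abs_neg, abs_of_nonneg (by positivity)]; exact hk)
      rw [show -((k : ℤ) + 1) + 1 = -k by ring] at h2
      have h3 := abs_sub_abs_le_abs_sub (w (k + 1)) (w k)
      have h4 := abs_sub_abs_le_abs_sub (w (-(k + 1))) (w (-k))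
      rw [abs_sub_comm] at h4
      constructor <;> linarith
  obtain ⟨k, rfl | rfl⟩ := α.eq_nat_or_neg
  · simpa using (key k (by simpa using hα)).1
  · simpa using (key k (by simpa using hα)).2

/-- If the divided differences of `u` have the limit `φ'` and `u n 0 → φ 0`, then `u` has
the limit `φ`. -/
theorem TendstoOnGrid.of_hasDerivAt {u v : ℕ → ℤ → ℝ} {φ ψ : ℝ → ℝ}
    (hψ : Continuous ψ) (hφ : ∀ x, HasDerivAt φ (ψ x) x) (hv : TendstoOnGrid v ψ)
    (huv : TendstoOnGrid (fun n α => 2 ^ n * (u n (α + 1) - u n α) - v n α) 0)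
    (hzero : Tendsto (fun n => u n 0) atTop (𝓝 (φ 0))) : TendstoOnGrid u φ := by
  intro Q ε hε
  -- Each grid step costs 3η/2^n: one η each for v - ψ, for the divided difference minus v, and for
  -- the oscillation of ψ. At most Q 2^n steps from 0 cost 3Qη ≤ ε/2; the + 1 covers Q = 0.
  set η : ℝ := ε / (2 * (3 * Q + 1)) with hη
  have hηpos : 0 < η := by positivity
  have huc := (isCompact_Icc (a := -((Q : ℝ) + 1)) (b := Q + 1)).uniformContinuousOn_of_continuous
    hψ.continuousOn
  obtain ⟨δ, hδ, hosc⟩ := Metric.uniformContinuousOn_iff.1 huc η hηpos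
  have hpow : ∀ᶠ n : ℕ in atTop, (1 / 2 : ℝ) ^ n < δ :=
    (tendsto_pow_atTop_nhds_zero_of_lt_one (by norm_num) (by norm_num)).eventually
      (gt_mem_nhds hδ)
  have hz : ∀ᶠ n : ℕ in atTop, |u n 0 - φ 0| < ε / 2 := by
    simpa [Real.dist_eq] using (Metric.tendsto_atTop'.1 hzero (ε / 2) (by positivity)) |>.elim
      fun N hN => (eventually_gt_atTop N).mono hN
  filter_upwards [hv Q η hηpos, huv Q η hηpos, hpow, hz] with n h1 h2 h3 h4 α hα
  have hp : (0 : ℝ) < 2 ^ n := by positivity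
  have hp1 : (1 : ℝ) ≤ 2 ^ n := one_le_pow₀ (by norm_num)
  have hstep : ∀ γ : ℤ, |γ| ≤ Q * 2 ^ n →
      |(u n (γ + 1) - φ (((γ + 1 : ℤ) : ℝ) / 2 ^ n)) - (u n γ - φ ((γ : ℝ) / 2 ^ n))|
        ≤ 3 * η / 2 ^ n := by
    intro γ hγ
    have hx := abs_le.1 (abs_div_two_pow_le hγ)
    set x : ℝ := (γ : ℝ) / 2 ^ n with hxdef
    have hy : ((γ + 1 : ℤ) : ℝ) / 2 ^ n = x + 1 / 2 ^ n := by push_cast; rw [add_div]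
    have hs : (0 : ℝ) < 1 / 2 ^ n := by positivity
    have hs1 : (1 : ℝ) / 2 ^ n ≤ 1 := by rw [div_le_one hp]; exact hp1
    -- The mean value point may lie up to 2^(-n) ≤ 1 beyond Q, whence the enlarged interval for
    -- uniform continuity.
    obtain ⟨ξ, ⟨hξ1, hξ2⟩, hξ⟩ := exists_hasDerivAt_eq_slope φ ψ
      (show x < x + 1 / 2 ^ n by linarith)
      (fun y _ => (hφ y).continuousAt.continuousWithinAt) (fun y _ => hφ y)
    have hd : φ (x + 1 / 2 ^ n) - φ x = ψ ξ / 2 ^ n := by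
      rw [hξ]; field_simp; ring
    have hclose : |ψ ξ - ψ x| < η := by
      rw [← Real.dist_eq]
      refine hosc ξ ⟨by linarith, by linarith⟩ x ⟨by linarith, by linarith⟩ ?_
      rw [Real.dist_eq, abs_of_pos (by linarith)]
      rw [one_div_pow] at h3
      linarith
    have a1 := abs_le.1 (h1 γ hγ)
    have a2 := abs_le.1 (h2 γ hγ)
    have a3 := abs_lt.1 hclose
    simp only [Pi.zero_apply, sub_zero] at a2
    rw [hy, le_div_iff₀ hp, ← abs_of_pos hp, ← abs_mul, abs_of_pos hp]
    have e : (u n (γ + 1) - φ (x + 1 / 2 ^ n) - (u n γ - φ x)) * 2 ^ n =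
        2 ^ n * (u n (γ + 1) - u n γ) - ψ ξ := by
      have : ψ ξ = (φ (x + 1 / 2 ^ n) - φ x) * 2 ^ n := by rw [hd]; field_simp
      rw [this]; ring
    rw [e, abs_le]
    constructor <;> linarith
  have hfin := abs_le_of_diff_le (w := fun γ => u n γ - φ ((γ : ℝ) / 2 ^ n)) hstep hα
  simp only [Int.cast_zero, zero_div] at hfin
  have hαQ : |(α : ℝ)| ≤ Q * 2 ^ n := by exact_mod_cast hα
  have : |(α : ℝ)| * (3 * η / 2 ^ n) ≤ ε / 2 := by
    calc |(α : ℝ)| * (3 * η / 2 ^ n) ≤ (Q * 2 ^ n) * (3 * η / 2 ^ n) := by gcongr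
      _ = 3 * Q * η := by field_simp
      _ ≤ (3 * Q + 1) * η := by gcongr; linarith
      _ = ε / 2 := by rw [hη]; field_simp
  linarith

/-! ### Finitely supported masks: locality, bounds and geometric decay -/

theorem exists_supportBound {A : MatSeq d} (hA : (Function.support A).Finite) :
    ∃ R : ℕ, ∀ α : ℤ, (R : ℤ) < |α| → A α = 0 := by
  obtain ⟨R, hR⟩ := (hA.image Int.natAbs).bddAbove
  refine ⟨R, fun α hα => by_contra fun h => ?_⟩
  have : α.natAbs ≤ R := hR ⟨α, h, rfl⟩
  rw [Int.abs_eq_natAbs] at hα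
  omega

theorem mask_sub_eq_zero {A : MatSeq d} {R : ℕ} (hR : ∀ α : ℤ, (R : ℤ) < |α| → A α = 0)
    {α β M : ℤ} (hM : |α| + R ≤ M) (hβ : β ∉ Finset.Icc (-M) M) : A (α - 2 * β) = 0 := by
  refine hR _ ?_
  by_contra! h
  refine hβ (Finset.mem_Icc.2 ?_)
  rw [abs_le] at h
  have := le_abs_self α
  have := neg_abs_le α
  have := abs_nonneg α
  constructor <;> linarith

theorem subdivOp_eq_sum {A : MatSeq d} (c : VecSeq d) (α : ℤ) (s : Finset ℤ)
    (hs : ∀ β, β ∉ s → A (α - 2 * β) = 0) :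
    subdivOp A c α = ∑ β ∈ s, A (α - 2 * β) *ᵥ c β := by
  refine finsum_eq_sum_of_support_subset _ fun β hβ => ?_
  by_contra h
  exact hβ (by simp [hs β h])

theorem subdivOp_apply_eq_sum {A : MatSeq d} (c : VecSeq d) (α : ℤ) (s : Finset ℤ)
    (hs : ∀ β, β ∉ s → A (α - 2 * β) = 0) (i : Fin (d + 1)) :
    subdivOp A c α i = ∑ β ∈ s, ∑ j, A (α - 2 * β) i j * c β j := by
  rw [subdivOp_eq_sum c α s hs, Finset.sum_apply]
  rfl

theorem subdivOp_congr {A : MatSeq d} {R : ℕ} (hR : ∀ α : ℤ, (R : ℤ) < |α| → A α = 0)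
    {c c' : VecSeq d} {α : ℤ} (h : ∀ β : ℤ, |α - 2 * β| ≤ R → c β = c' β) :
    subdivOp A c α = subdivOp A c' α := by
  refine finsum_congr fun β => ?_
  rcases le_or_gt |α - 2 * β| (R : ℤ) with hβ | hβ
  · rw [h β hβ]
  · simp [hR _ hβ]

theorem subdivOp_smul (A : MatSeq d) (a : ℝ) (c : VecSeq d) :
    subdivOp A (a • c) = a • subdivOp A c := by
  ext α i
  simp only [subdivOp, Pi.smul_apply, Matrix.mulVec_smul]
  rw [← smul_finsum]
  rfl

theorem abs_mulVec_le (M : Matrix (Fin (d + 1)) (Fin (d + 1)) ℝ) (v : Fin (d + 1) → ℝ) :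
    ‖M *ᵥ v‖ ≤ (∑ i, ∑ j, |M i j|) * ‖v‖ := by
  refine (pi_norm_le_iff_of_nonneg (by positivity)).2 fun i => ?_
  calc ‖(M *ᵥ v) i‖ ≤ ∑ j, ‖M i j * v j‖ := norm_sum_le Finset.univ fun j => M i j * v j
    _ ≤ ∑ j, |M i j| * ‖v‖ := by
        gcongr with j
        rw [norm_mul, Real.norm_eq_abs (M i j)]
        gcongr
        exact norm_le_pi_norm v j
    _ = (∑ j, |M i j|) * ‖v‖ := by rw [Finset.sum_mul]
    _ ≤ _ := by
        refine mul_le_mul_of_nonneg_right ?_ (norm_nonneg _)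
        exact Finset.single_le_sum (f := fun i => ∑ j, |M i j|)
          (fun i _ => by positivity) (Finset.mem_univ i)

/-- Since β ↦ α - 2β is injective, the total mass of the mask serves as a constant independent of α
and c. Only the sites read at α need a bound. -/
theorem exists_subdivOp_bound {A : MatSeq d} {R : ℕ} (hR : ∀ α : ℤ, (R : ℤ) < |α| → A α = 0) :
    ∃ Λ : ℝ, 0 ≤ Λ ∧ ∀ (c : VecSeq d) (M : ℝ) (α : ℤ), 0 ≤ M →
      (∀ β : ℤ, |α - 2 * β| ≤ R → ‖c β‖ ≤ M) → ‖subdivOp A c α‖ ≤ Λ * M := by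
  classical
  refine ⟨∑ γ ∈ Finset.Icc (-(R : ℤ)) R, ∑ i, ∑ j, |A γ i j|, by positivity,
    fun c M α hM hc => ?_⟩
  set s : Finset ℤ := (Finset.Icc (-(|α| + R)) (|α| + R)).filter fun β => |α - 2 * β| ≤ R
  have hs : ∀ β, β ∉ s → A (α - 2 * β) = 0 := by
    intro β hβ
    by_cases h : β ∈ Finset.Icc (-(|α| + R)) (|α| + R)
    · exact hR _ (not_le.1 fun h' => hβ (Finset.mem_filter.2 ⟨h, h'⟩))
    · exact mask_sub_eq_zero hR le_rfl h
  rw [subdivOp_eq_sum c α s hs]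
  calc ‖∑ β ∈ s, A (α - 2 * β) *ᵥ c β‖
      ≤ ∑ β ∈ s, (∑ i, ∑ j, |A (α - 2 * β) i j|) * M := by
        refine (norm_sum_le _ _).trans (Finset.sum_le_sum fun β hβ => ?_)
        refine (abs_mulVec_le _ _).trans ?_
        gcongr
        exact hc β (Finset.mem_filter.1 hβ).2
    _ = (∑ γ ∈ s.image fun β => α - 2 * β, ∑ i, ∑ j, |A γ i j|) * M := by
        rw [Finset.sum_mul, Finset.sum_image fun x _ y _ h => by simpa using h]
    _ ≤ _ := by
        refine mul_le_mul_of_nonneg_right ?_ hM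
        refine Finset.sum_le_sum_of_subset_of_nonneg (fun γ hγ => ?_) fun _ _ _ => by positivity
        obtain ⟨β, hβ, rfl⟩ := Finset.mem_image.1 hγ
        exact Finset.mem_Icc.2 (abs_le.1 (Finset.mem_filter.1 hβ).2)

/-- The windows Q 2^n + R are compatible with refinement: a site at level n + 1 in its window reads
only sites in the window of level n. -/
theorem iterate_subdivOp_congr {A : MatSeq d} {R : ℕ}
    (hR : ∀ α : ℤ, (R : ℤ) < |α| → A α = 0) {c c' : VecSeq d} {Q : ℕ}
    (h : ∀ β : ℤ, |β| ≤ Q + R → c β = c' β) (n : ℕ) :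
    ∀ α : ℤ, |α| ≤ Q * 2 ^ n + R → (subdivOp A)^[n] c α = (subdivOp A)^[n] c' α := by
  induction n with
  | zero => simpa using h
  | succ n ih =>
    intro α hα
    rw [Function.iterate_succ_apply', Function.iterate_succ_apply']
    refine subdivOp_congr hR fun β hβ => ih β ?_
    rw [pow_succ, ← mul_assoc] at hα
    rw [abs_le] at hα hβ ⊢
    constructor <;> omega

/-- Iterates of a contractive subdivision operator decay geometrically, locally uniformly. -/
theorem IsContractive.exists_geometric {B : MatSeq d} (hB : (Function.support B).Finite)
    (h : IsContractive B) :
    ∃ r : ℝ, 0 < r ∧ r < 1 ∧ ∀ (c : VecSeq d) (Q : ℕ), ∃ C : ℝ, 0 ≤ C ∧ ∀ (n : ℕ) (α : ℤ),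
      |α| ≤ Q * 2 ^ n → ‖(subdivOp B)^[n] c α‖ ≤ C * r ^ n := by
  classical
  obtain ⟨R, hR⟩ := exists_supportBound hB
  obtain ⟨Λ, hΛ, hbound⟩ := exists_subdivOp_bound hR
  obtain ⟨N, hN, ρ, hρ, hcontr⟩ := h
  -- Positivity of ρ' makes its N-th root r positive, so division by r^n is allowed.
  set ρ' := max ρ (1 / 2)
  have hρ'0 : 0 < ρ' := lt_max_of_lt_right (by norm_num)
  have hρ'1 : ρ' < 1 := max_lt hρ (by norm_num)
  have hN0 : N ≠ 0 := by omega
  set r := ρ' ^ ((N : ℝ)⁻¹)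
  have hr0 : 0 < r := Real.rpow_pos_of_pos hρ'0 _
  have hrN : r ^ N = ρ' := Real.rpow_inv_natCast_pow hρ'0.le hN0
  have hr1 : r < 1 := Real.rpow_lt_one hρ'0.le hρ'1 (by positivity)
  refine ⟨r, hr0, hr1, fun c Q => ?_⟩
  -- Contractivity concerns bounded data only; truncation makes c bounded without changing the
  -- iterates on the window.
  set c' : VecSeq d := fun β => if |β| ≤ Q + R then c β else 0
  obtain ⟨M, hM0, hM⟩ : ∃ M : ℝ, 0 ≤ M ∧ ∀ β, ‖c' β‖ ≤ M := by
    refine ⟨∑ β ∈ Finset.Icc (-(Q + R : ℤ)) (Q + R), ‖c β‖, by positivity, fun β => ?_⟩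
    by_cases hβ : |β| ≤ (Q + R : ℤ)
    · simp only [c', if_pos hβ]
      exact Finset.single_le_sum (f := fun β => ‖c β‖) (fun _ _ => norm_nonneg _)
        (Finset.mem_Icc.2 (abs_le.1 hβ))
    · simp only [c', if_neg hβ, norm_zero]
      positivity
  have hpow : ∀ n α, ‖(subdivOp B)^[n] c' α‖ ≤ Λ ^ n * M := by
    intro n
    induction n with
    | zero => simpa using hM
    | succ n ih =>
      intro α
      rw [Function.iterate_succ_apply', pow_succ', mul_assoc]
      exact hbound _ _ α (by positivity) fun β _ => ih β
  -- C absorbs the crude bounds for the first N iterates; later ones are reached by steps of N, each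
  -- gaining ρ' = r^N.
  set C : ℝ := ∑ n ∈ Finset.range N, Λ ^ n * M / r ^ n
  have hC : 0 ≤ C := by positivity
  have hdecay : ∀ n α, ‖(subdivOp B)^[n] c' α‖ ≤ C * r ^ n := by
    intro n
    induction n using Nat.strong_induction_on with
    | _ n ih =>
      intro α
      rcases lt_or_ge n N with hn | hn
      · refine (hpow n α).trans ?_
        rw [← div_le_iff₀ (by positivity)]
        exact Finset.single_le_sum (f := fun n => Λ ^ n * M / r ^ n)
          (fun _ _ => by positivity) (Finset.mem_range.2 hn)
      · obtain ⟨m, rfl⟩ := Nat.exists_eq_add_of_le hn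
        rw [Function.iterate_add_apply]
        refine (hcontr _ (C * r ^ m) (ih m (by omega)) α).trans ?_
        rw [pow_add, hrN]
        calc ρ * (C * r ^ m) ≤ ρ' * (C * r ^ m) := by gcongr; exact le_max_left _ _
          _ = _ := by ring
  refine ⟨C, hC, fun n α hα => ?_⟩
  rw [iterate_subdivOp_congr hR (c' := c') (Q := Q) (fun β hβ => by simp only [c', if_pos hβ]) n α
    (by omega)]
  exact hdecay n α

/-! ### Unscaling the Hermite scheme and iterating the factorization -/

/-- The inner powers of D cancel between consecutive levels, leaving only the outer factor D^(-n).
-/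
theorem hermiteRefine_eq {A : MatSeq d} (hA : (Function.support A).Finite) (f₀ : VecSeq d) (n : ℕ) (α : ℤ) (i : Fin (d + 1)) :
    hermiteRefine A f₀ n α i = 2 ^ (n * (i : ℕ)) * (subdivOp A)^[n] f₀ α i := by
  have hmask : ∀ (n : ℕ) (γ : ℤ) (i j : Fin (d + 1)),
      hermiteMask A n γ i j = 2 ^ ((n + 1) * (i : ℕ)) * A γ i j * (1 / 2) ^ (n * (j : ℕ)) := by
    intro n γ i j
    have hinv : (scaleMatrix d)⁻¹ = Matrix.diagonal fun k : Fin (d + 1) => (2 : ℝ) ^ (k : ℕ) := by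
      refine Matrix.inv_eq_left_inv ?_
      rw [scaleMatrix, Matrix.diagonal_mul_diagonal, ← Matrix.diagonal_one]
      congr 1
      ext k
      rw [← mul_pow]
      norm_num
    rw [hermiteMask, hinv, scaleMatrix, Matrix.diagonal_pow, Matrix.diagonal_pow,
      Matrix.mul_diagonal, Matrix.diagonal_mul]
    simp only [Pi.pow_apply]
    rw [← pow_mul, ← pow_mul, mul_comm (i : ℕ), mul_comm (j : ℕ)]
  induction n generalizing α i with
  | zero => simp [hermiteRefine]
  | succ n ih =>
    rw [Function.iterate_succ_apply']
    change subdivOp (hermiteMask A n) (hermiteRefine A f₀ n) α i = _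
    obtain ⟨R, hR⟩ := exists_supportBound hA
    rw [subdivOp_apply_eq_sum _ α (Finset.Icc (-(|α| + R)) (|α| + R))
        (fun β hβ => mask_sub_eq_zero hR le_rfl hβ),
      subdivOp_apply_eq_sum _ α (Finset.Icc (-(|α| + R)) (|α| + R))
        (fun β hβ => by simp [hermiteMask, mask_sub_eq_zero hR le_rfl hβ]), Finset.mul_sum]
    refine Finset.sum_congr rfl fun β _ => ?_
    rw [Finset.mul_sum]
    refine Finset.sum_congr rfl fun j _ => ?_
    rw [hmask, ih]
    have : (1 / 2 : ℝ) ^ (n * (j : ℕ)) * 2 ^ (n * (j : ℕ)) = 1 := by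
      rw [← mul_pow]; norm_num
    linear_combination (2 ^ ((n + 1) * (i : ℕ)) * A (α - 2 * β) i j *
      (subdivOp A)^[n] f₀ β j) * this

theorem taylor_iterate {A B : MatSeq d} {T : VecSeq d → VecSeq d}
    (hfactor : ∀ c : VecSeq d, T (subdivOp A c) = ((2 : ℝ) ^ d)⁻¹ • subdivOp B (T c))
    (f : VecSeq d) (n : ℕ) :
    T ((subdivOp A)^[n] f) = (((2 : ℝ) ^ d)⁻¹) ^ n • (subdivOp B)^[n] (T f) := by
  induction n with
  | zero => simp
  | succ n ih =>
    rw [Function.iterate_succ_apply', hfactor, ih, subdivOp_smul, smul_smul, ← pow_succ',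
      Function.iterate_succ_apply']

/-! ### Convergence of the last component -/

theorem sum_eq_of_symbol {B : MatSeq d} {R : ℕ} (hR : ∀ α : ℤ, (R : ℤ) < |α| → B α = 0)
    {i j : Fin (d + 1)} {a : ℝ} (h : symbol B 1 i j = a) :
    ∑ γ ∈ Finset.Icc (-(R : ℤ)) R, B γ i j = a := by
  have hs : symbol B 1 = ∑ γ ∈ Finset.Icc (-(R : ℤ)) R, (B γ).map Complex.ofReal := by
    unfold symbol
    simp only [one_zpow, one_smul]
    refine finsum_eq_sum_of_support_subset _ fun γ hγ => ?_
    by_contra hn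
    refine hγ ?_
    have : B γ = 0 := hR γ (by by_contra! h'; exact hn (by simpa using abs_le.1 h'))
    ext
    simp [this]
  rw [hs, Matrix.sum_apply] at h
  simp only [Matrix.map_apply] at h
  exact_mod_cast h

/-- If the last row of `B - δ₁ I` has vanishing sum, it is the difference of a mask `C`. -/
theorem exists_mask_fwdDiff {B : MatSeq d} {R : ℕ} (hR1 : 1 ≤ R)
    (hR : ∀ α : ℤ, (R : ℤ) < |α| → B α = 0)
    (hsum : ∀ j, ∑ γ ∈ Finset.Icc (-(R : ℤ)) R, B γ (Fin.last d) j =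
      if j = Fin.last d then 1 else 0) :
    ∃ C : MatSeq d, (∀ α : ℤ, (R : ℤ) < |α| → C α = 0) ∧ ∀ (α : ℤ) (j : Fin (d + 1)),
      C (α + 1) (Fin.last d) j - C α (Fin.last d) j =
        B α (Fin.last d) j - if α = 1 ∧ j = Fin.last d then 1 else 0 := by
  classical
  set K : ℤ → Fin (d + 1) → ℝ := fun α j =>
    B α (Fin.last d) j - if α = 1 ∧ j = Fin.last d then 1 else 0 with hK
  have hK0 : ∀ α : ℤ, (R : ℤ) < |α| → ∀ j, K α j = 0 := by
    intro α hα j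
    have : α ≠ 1 := by rintro rfl; rw [abs_one] at hα; omega
    simp [hK, hR α hα, this]
  have hKsum : ∀ j, ∑ γ ∈ Finset.Icc (-(R : ℤ)) R, K γ j = 0 := by
    intro j
    rw [hK]
    simp only [Finset.sum_sub_distrib]
    rw [hsum, sub_eq_zero]
    split_ifs with hj
    · simp only [hj, and_true]
      rw [Finset.sum_ite_eq' , if_pos (by rw [Finset.mem_Icc]; omega)]
    · simp [hj]
  -- C is the partial sum of K; it vanishes to the right of R because K has total sum zero. Only the
  -- last row matters.
  refine ⟨fun α => Matrix.of fun i j =>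
    if i = Fin.last d then ∑ γ ∈ Finset.Ico (-(R : ℤ)) α, K γ j else 0, fun α hα => ?_,
    fun α j => ?_⟩
  · ext i j
    simp only [Matrix.of_apply, Matrix.zero_apply, ite_eq_right_iff]
    rintro -
    rcases lt_abs.1 hα with h | h
    · rw [← hKsum j]
      refine (Finset.sum_subset (fun γ hγ => ?_) fun γ _ hγ => hK0 γ ?_ j).symm
      · rw [Finset.mem_Icc] at hγ
        rw [Finset.mem_Ico]
        omega
      · by_contra! h'
        exact hγ (Finset.mem_Icc.2 (abs_le.1 h'))
    · rw [Finset.Ico_eq_empty (by omega), Finset.sum_empty]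
  · simp only [Matrix.of_apply, if_true]
    change _ = K α j
    rcases le_or_gt (-(R : ℤ)) α with h | h
    · have : Finset.Ico (-(R : ℤ)) (α + 1) = insert α (Finset.Ico (-(R : ℤ)) α) := by
        ext γ
        simp only [Finset.mem_Ico, Finset.mem_insert]
        omega
      rw [this, Finset.sum_insert (by simp)]
      ring
    · rw [Finset.Ico_eq_empty (by omega), Finset.Ico_eq_empty (by omega),
        hK0 α (lt_abs.2 (Or.inr (by omega)))]
      simp

theorem IsCompleteTaylorOp.apply_last {T : VecSeq d → VecSeq d} (hT : IsCompleteTaylorOp T)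
    (f : VecSeq d) (α : ℤ) :
    T f α (Fin.last d) = f (α + 1) (Fin.last d) - f α (Fin.last d) := by
  obtain ⟨t, ht, -, hTt⟩ := hT
  have : (t *ᵥ f α) (Fin.last d) = 0 := by
    rw [Matrix.mulVec, dotProduct]
    exact Finset.sum_eq_zero fun k _ => by rw [ht _ _ (Fin.le_last k), zero_mul]
  rw [hTt, Pi.add_apply, this, add_zero]
  rfl

theorem subdivOp_zero (A : MatSeq d) : subdivOp A 0 = 0 := by
  ext α i
  simp [subdivOp]

/-- The last component of `2ᵈ S_A g` differs from the piecewise constant upsampling of `g` by a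
finitely supported operator applied to `T g`. -/
theorem exists_last_component_factorization {A B : MatSeq d}
    (hA : (Function.support A).Finite) (hB : (Function.support B).Finite)
    {T : VecSeq d → VecSeq d} (hT : IsCompleteTaylorOp T)
    (hfactor : ∀ c : VecSeq d, T (subdivOp A c) = ((2 : ℝ) ^ d)⁻¹ • subdivOp B (T c))
    (hB21 : ∀ j : Fin d, symbol B 1 (Fin.last d) j.castSucc = 0)
    (hB22 : symbol B 1 (Fin.last d) (Fin.last d) = 1) :
    ∃ (C : MatSeq d) (R : ℕ), (∀ α : ℤ, (R : ℤ) < |α| → C α = 0) ∧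
      ∀ (g : VecSeq d) (α : ℤ), 2 ^ d * subdivOp A g α (Fin.last d) - g (α / 2) (Fin.last d) =
        subdivOp C (T g) α (Fin.last d) := by
  classical
  obtain ⟨RA, hRA⟩ := exists_supportBound hA
  obtain ⟨RB, hRB⟩ := exists_supportBound hB
  set R := RA + RB + 1
  replace hRA : ∀ α : ℤ, (R : ℤ) < |α| → A α = 0 := fun α hα => hRA α (by omega)
  replace hRB : ∀ α : ℤ, (R : ℤ) < |α| → B α = 0 := fun α hα => hRB α (by omega)
  obtain ⟨C, hC, hdiff⟩ := exists_mask_fwdDiff (by omega) hRB fun j => by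
    refine sum_eq_of_symbol hRB ?_
    induction j using Fin.lastCases with
    | last => simpa using hB22
    | cast j => simpa [j.castSucc_lt_last.ne] using hB21 j
  refine ⟨C, R, hC, ?_⟩
  have hlast := hT.apply_last
  obtain ⟨t, -, -, hTt⟩ := hT
  -- The defect P of the claimed identity has zero difference in α, hence is constant. It vanishes
  -- for finitely supported g because every term is zero far away, and locality reduces general g to
  -- that case.
  set P : VecSeq d → ℤ → ℝ := fun g α =>
    2 ^ d * subdivOp A g α (Fin.last d) - g (α / 2) (Fin.last d) -
      subdivOp C (T g) α (Fin.last d) with hP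
  have hPstep : ∀ g α, P g (α + 1) = P g α := by
    intro g α
    obtain ⟨h, hh⟩ : ∃ h, h = T g := ⟨_, rfl⟩
    set M : ℤ := |α| + 1 + R
    have hM : |α| + R ≤ M := by omega
    have hM' : |α + 1| + R ≤ M := by
      have := abs_add_le α 1
      rw [abs_one] at this
      omega
    have e1 : 2 ^ d * (subdivOp A g (α + 1) (Fin.last d) - subdivOp A g α (Fin.last d)) =
        subdivOp B h α (Fin.last d) := by
      rw [← hlast, hfactor, hh]
      simp only [Pi.smul_apply, smul_eq_mul]
      field_simp
    have e2 : subdivOp C h (α + 1) (Fin.last d) - subdivOp C h α (Fin.last d) =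
        subdivOp B h α (Fin.last d) -
          ∑ β ∈ Finset.Icc (-M) M, if α - 2 * β = 1 then h β (Fin.last d) else 0 := by
      rw [subdivOp_apply_eq_sum h _ _ fun β hβ => mask_sub_eq_zero hC hM' hβ,
        subdivOp_apply_eq_sum h _ _ fun β hβ => mask_sub_eq_zero hC hM hβ,
        subdivOp_apply_eq_sum h _ _ fun β hβ => mask_sub_eq_zero hRB hM hβ,
        ← Finset.sum_sub_distrib, ← Finset.sum_sub_distrib]
      refine Finset.sum_congr rfl fun β _ => ?_
      have : (if α - 2 * β = 1 then h β (Fin.last d) else 0) =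
          ∑ j, (if α - 2 * β = 1 ∧ j = Fin.last d then 1 else 0) * h β j := by
        by_cases hαβ : α - 2 * β = 1 <;> simp [hαβ]
      rw [this, ← Finset.sum_sub_distrib, ← Finset.sum_sub_distrib]
      refine Finset.sum_congr rfl fun j _ => ?_
      rw [← sub_mul, ← sub_mul, ← hdiff, show α + 1 - 2 * β = α - 2 * β + 1 by ring]
    have e3 : g ((α + 1) / 2) (Fin.last d) - g (α / 2) (Fin.last d) =
        ∑ β ∈ Finset.Icc (-M) M, if α - 2 * β = 1 then h β (Fin.last d) else 0 := by
      rcases Int.even_or_odd' α with ⟨m, hm | hm⟩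
      · rw [Finset.sum_eq_zero fun β _ => if_neg (by omega), show (α + 1) / 2 = α / 2 by omega,
          sub_self]
      · rw [Finset.sum_eq_single m (fun β _ hβ => if_neg (by omega)) fun hm' => ?_,
          if_pos (by omega), hh, hlast, show (α + 1) / 2 = m + 1 by omega,
          show α / 2 = m by omega]
        refine absurd (Finset.mem_Icc.2 ?_) hm'
        have := le_abs_self α
        have := neg_abs_le α
        omega
    simp only [hP, ← hh]
    linear_combination e1 - e2 - e3
  have hPconst : ∀ g α, P g α = P g 0 := fun g α => by
    simpa using Function.Periodic.int_mul_eq (f := P g) (c := 1) (hPstep g) α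
  intro g α
  rw [← sub_eq_zero]
  change P g α = 0
  set M : ℤ := |α| + R + 1 with hM
  have hα0 := abs_nonneg α
  have hα1 := le_abs_self α
  have hα2 := neg_abs_le α
  set g' : VecSeq d := fun β => if |β| ≤ M then g β else 0 with hg'
  have hg1 : ∀ β, |β| ≤ M → g β = g' β := fun β hβ => by simp only [hg', if_pos hβ]
  have hg2 : ∀ β, M < |β| → g' β = 0 := fun β hβ => by simp only [hg', if_neg hβ.not_ge]
  have e1 : P g α = P g' α := by
    have a1 : subdivOp A g α = subdivOp A g' α := subdivOp_congr hRA fun β hβ => hg1 β <| by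
      rw [abs_le] at hβ ⊢
      constructor <;> linarith
    have a2 : subdivOp C (T g) α = subdivOp C (T g') α := subdivOp_congr hC fun β hβ => by
      rw [abs_le] at hβ
      have b1 : g β = g' β := hg1 β <| by
        rw [abs_le]
        constructor <;> linarith
      have b2 : g (β + 1) = g' (β + 1) := hg1 _ <| by
        rw [abs_le]
        constructor <;> omega
      rw [hTt, hTt, fwdDiff, fwdDiff, b1, b2]
    have a3 : g (α / 2) = g' (α / 2) := hg1 _ <| by
      rw [abs_le]
      constructor <;> omega
    simp only [hP, a1, a2, a3]
  -- Chosen so that every site read at γ, including γ / 2, exceeds M, outside the support of g'.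
  set γ : ℤ := 2 * M + R + 2 with hγ
  have e2 : P g' γ = 0 := by
    have hz : ∀ β : ℤ, |γ - 2 * β| ≤ R → M < β := by
      intro β hβ
      rw [abs_le] at hβ
      omega
    have a1 : subdivOp A g' γ = 0 := by
      rw [subdivOp_congr hRA (c' := 0) fun β hβ => hg2 β (lt_abs.2 (Or.inl (hz β hβ))),
        subdivOp_zero]
      rfl
    have a2 : subdivOp C (T g') γ = 0 := by
      rw [subdivOp_congr hC (c' := 0) fun β hβ => ?_, subdivOp_zero]
      · rfl
      · have := hz β hβ
        rw [hTt, fwdDiff, hg2 β (lt_abs.2 (Or.inl this)),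
          hg2 (β + 1) (lt_abs.2 (Or.inl (by omega)))]
        simp
    have a3 : g' (γ / 2) = 0 := hg2 _ (lt_abs.2 (Or.inl (by omega)))
    simp [hP, a1, a2, a3]
  rw [e1, hPconst, ← hPconst g' γ, e2]

/-- Rescaled form of the relation `T f_n`. -/
theorem two_pow_mul_taylor_hermite {A B : MatSeq d} {T : VecSeq d → VecSeq d}
    (hfactor : ∀ c : VecSeq d, T (subdivOp A c) = ((2 : ℝ) ^ d)⁻¹ • subdivOp B (T c))
    (f : VecSeq d) (n : ℕ) :
    (2 : ℝ) ^ (n * d) • T ((subdivOp A)^[n] f) = (subdivOp B)^[n] (T f) := by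
  rw [taylor_iterate hfactor, smul_smul, inv_pow, ← pow_mul, mul_comm d n,
    mul_inv_cancel₀ (by positivity), one_smul]

theorem exists_limit_last_component {A B : MatSeq d}
    (hA : (Function.support A).Finite) (hB : (Function.support B).Finite)
    {T : VecSeq d → VecSeq d} (hT : IsCompleteTaylorOp T)
    (hfactor : ∀ c : VecSeq d, T (subdivOp A c) = ((2 : ℝ) ^ d)⁻¹ • subdivOp B (T c))
    (hcontr : IsContractive B)
    (hB21 : ∀ j : Fin d, symbol B 1 (Fin.last d) j.castSucc = 0)
    (hB22 : symbol B 1 (Fin.last d) (Fin.last d) = 1) (f₀ : VecSeq d) :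
    ∃ ψ : ℝ → ℝ, Continuous ψ ∧
      TendstoOnGrid (fun n α => hermiteRefine A f₀ n α (Fin.last d)) ψ := by
  obtain ⟨r, hr0, hr1, hdecay⟩ := hcontr.exists_geometric hB
  obtain ⟨C, R, hC, hfac⟩ :=
    exists_last_component_factorization hA hB hT hfactor hB21 hB22
  obtain ⟨Λ, hΛ, hbound⟩ := exists_subdivOp_bound hC
  refine exists_continuous_tendstoOnGrid hr0.le hr1 (fun Q => ?_) fun Q => ?_
  -- The mask C reads up to R sites outside the window; R ≤ R 2^n absorbs them.
  · obtain ⟨D, hD0, hD⟩ := hdecay (T f₀) (Q + R)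
    refine ⟨Λ * D, fun n α hα => ?_⟩
    have e : hermiteRefine A f₀ (n + 1) α (Fin.last d) -
        hermiteRefine A f₀ n (α / 2) (Fin.last d) =
        subdivOp C ((subdivOp B)^[n] (T f₀)) α (Fin.last d) := by
      rw [← two_pow_mul_taylor_hermite hfactor, subdivOp_smul, Pi.smul_apply, Pi.smul_apply,
        ← hfac, hermiteRefine_eq hA, hermiteRefine_eq hA, Function.iterate_succ_apply',
        smul_eq_mul, Fin.val_last]
      ring
    rw [e, mul_assoc, ← Real.norm_eq_abs]
    refine (norm_le_pi_norm _ _).trans (hbound _ _ _ (by positivity) fun β hβ => hD n β ?_)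
    have hp : (R : ℤ) * 1 ≤ R * 2 ^ n := by
      gcongr
      exact one_le_pow₀ (by norm_num)
    rw [pow_succ, ← mul_assoc] at hα
    push_cast
    rw [add_mul]
    rw [abs_le] at hα hβ ⊢
    constructor <;> linarith
  · obtain ⟨D, hD0, hD⟩ := hdecay (T f₀) Q
    refine ⟨D, fun n α hα => ?_⟩
    have e : hermiteRefine A f₀ n (α + 1) (Fin.last d) - hermiteRefine A f₀ n α (Fin.last d) =
        (subdivOp B)^[n] (T f₀) α (Fin.last d) := by
      rw [← two_pow_mul_taylor_hermite hfactor, Pi.smul_apply, Pi.smul_apply, hT.apply_last,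
        hermiteRefine_eq hA, hermiteRefine_eq hA, smul_eq_mul, Fin.val_last]
      ring
    rw [e, ← Real.norm_eq_abs]
    exact (norm_le_pi_norm _ _).trans (hD n α hα)

/-! ### Divided differences of the lower components -/

/-- The divided differences of the `j`-th component approximate the next component, up to terms
in the higher components that tend to zero. -/
theorem tendstoOnGrid_divided_difference {A B : MatSeq d}
    (hA : (Function.support A).Finite) (hB : (Function.support B).Finite)
    {T : VecSeq d → VecSeq d} (hT : IsCompleteTaylorOp T)
    (hfactor : ∀ c : VecSeq d, T (subdivOp A c) = ((2 : ℝ) ^ d)⁻¹ • subdivOp B (T c))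
    (hcontr : IsContractive B) (f₀ : VecSeq d) {j j' : Fin (d + 1)}
    (hj' : (j' : ℕ) = j + 1) {φ : Fin (d + 1) → ℝ → ℝ} (hφ : ∀ k, Continuous (φ k))
    (hlim : ∀ k, j < k → TendstoOnGrid (fun n α => hermiteRefine A f₀ n α k) (φ k)) :
    TendstoOnGrid (fun n α => 2 ^ n * (hermiteRefine A f₀ n (α + 1) j -
      hermiteRefine A f₀ n α j) - hermiteRefine A f₀ n α j') 0 := by
  obtain ⟨r, hr0, hr1, hdecay⟩ := hcontr.exists_geometric hB
  obtain ⟨t, ht, ht1, hTt⟩ := hT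
  have hmain : TendstoOnGrid (fun n α => 2 ^ (n * (j + 1)) * (1 / 2) ^ (n * d) *
      (subdivOp B)^[n] (T f₀) α j) 0 := by
    refine tendstoOnGrid_zero_of_geometric hr0.le hr1 fun Q => ?_
    obtain ⟨D, hD0, hD⟩ := hdecay (T f₀) Q
    refine ⟨D, fun n α hα => ?_⟩
    -- The existence of j' forces j + 1 ≤ d.
    have h1 : (2 : ℝ) ^ (n * (j + 1)) * (1 / 2) ^ (n * d) ≤ 1 := by
      calc (2 : ℝ) ^ (n * (j + 1)) * (1 / 2) ^ (n * d)
          ≤ 2 ^ (n * d) * (1 / 2) ^ (n * d) := by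
            gcongr
            · norm_num
            · omega
        _ = 1 := by rw [← mul_pow]; norm_num
    rw [abs_mul, abs_of_nonneg (by positivity)]
    have h2 : |(subdivOp B)^[n] (T f₀) α j| ≤ D * r ^ n :=
      (norm_le_pi_norm ((subdivOp B)^[n] (T f₀) α) j).trans (hD n α hα)
    calc _ ≤ 1 * (D * r ^ n) := by gcongr
      _ = _ := one_mul _
  have hrest : ∀ k ∈ (Finset.univ : Finset (Fin (d + 1))), TendstoOnGrid (fun n α =>
      (if (j : ℕ) + 2 ≤ k then -t j k * (1 / 2) ^ (n * (k - (j + 1))) else 0) *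
        hermiteRefine A f₀ n α k) 0 := by
    intro k _
    by_cases hk : (j : ℕ) + 2 ≤ k
    · simp only [if_pos hk]
      refine (hlim k (Fin.lt_def.2 (by omega))).smul_zero (hφ k) ?_
      have := (tendsto_pow_atTop_nhds_zero_of_lt_one
        (show (0 : ℝ) ≤ (1 / 2) ^ ((k : ℕ) - (j + 1)) by positivity)
        (pow_lt_one₀ (by norm_num) (by norm_num) (by omega))).const_mul (-t j k)
      rw [mul_zero] at this
      refine this.congr fun n => ?_
      rw [← pow_mul, mul_comm n]
    · simp only [if_neg hk, zero_mul]
      exact tendstoOnGrid_zero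
  have hsum := hmain.add (TendstoOnGrid.sum Finset.univ hrest)
  convert hsum using 3 with n α
  set g := (subdivOp A)^[n] f₀
  have e1 : (1 / 2) ^ (n * d) * (subdivOp B)^[n] (T f₀) α j =
      g (α + 1) j - g α j + ∑ k, t j k * g α k := by
    rw [← two_pow_mul_taylor_hermite hfactor, Pi.smul_apply, Pi.smul_apply, smul_eq_mul,
      ← mul_assoc, ← mul_pow, hTt]
    norm_num [fwdDiff, Matrix.mulVec, dotProduct, g]
  -- Terms with k ≤ j vanish, those with k ≥ j + 2 cancel, and k = j + 1 survives with coefficient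
  -- -1. The guard keeps the truncated subtraction exact.
  have e2 : 2 ^ (n * (j + 1)) * ∑ k, t j k * g α k +
      ∑ k : Fin (d + 1), (if (j : ℕ) + 2 ≤ k then -t j k * (1 / 2) ^ (n * (k - (j + 1))) else 0) *
        hermiteRefine A f₀ n α k = -hermiteRefine A f₀ n α j' := by
    rw [Finset.mul_sum, ← Finset.sum_add_distrib, Finset.sum_eq_single j']
    · rw [ht1 j j' hj', if_neg (by omega), hermiteRefine_eq hA, hj']
      ring
    · intro k _ hk
      have hk' : (k : ℕ) ≠ j + 1 := fun h => hk (Fin.ext (h.trans hj'.symm))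
      by_cases h : (j : ℕ) + 2 ≤ k
      · have : (2 : ℝ) ^ (n * (k : ℕ)) = 2 ^ (n * (j + 1)) * 2 ^ (n * (k - (j + 1))) := by
          rw [← pow_add, ← mul_add]
          congr 2
          omega
        have h2 : (1 / 2 : ℝ) ^ (n * (k - (j + 1))) * 2 ^ (n * (k - (j + 1))) = 1 := by
          rw [← mul_pow]; norm_num
        rw [if_pos h, hermiteRefine_eq hA, this]
        linear_combination (-t j k * 2 ^ (n * (j + 1)) * g α k) * h2
      · rw [if_neg h, ht j k (Fin.le_def.2 (by omega))]
        ring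
    · simp
  rw [hermiteRefine_eq hA f₀ n _ j, hermiteRefine_eq hA f₀ n _ j]
  change 2 ^ n * (2 ^ (n * (j : ℕ)) * g (α + 1) j - 2 ^ (n * (j : ℕ)) * g α j) -
    hermiteRefine A f₀ n α j' = _
  rw [mul_assoc, e1]
  have e3 : (2 : ℝ) ^ (n * ((j : ℕ) + 1)) = 2 ^ n * 2 ^ (n * (j : ℕ)) := by ring
  linear_combination -e2 - (g (α + 1) j - g α j) * e3

/-! ### The limit function and the error sequence -/

/-- Iterated antiderivatives of `ψ` with prescribed values at zero. -/
noncomputable def antiderivTower (ψ : ℝ → ℝ) (y : ℕ → ℝ) : ℕ → ℝ → ℝ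
  | 0 => ψ
  | m + 1 => fun x => y (m + 1) + ∫ s in (0 : ℝ)..x, antiderivTower ψ y m s

theorem continuous_antiderivTower {ψ : ℝ → ℝ} (hψ : Continuous ψ) (y : ℕ → ℝ) (m : ℕ) :
    Continuous (antiderivTower ψ y m) := by
  induction m with
  | zero => exact hψ
  | succ m ih =>
    exact continuous_const.add (intervalIntegral.continuous_primitive
      (fun a b => ih.intervalIntegrable a b) 0)

theorem hasDerivAt_antiderivTower {ψ : ℝ → ℝ} (hψ : Continuous ψ) (y : ℕ → ℝ) (m : ℕ) (x : ℝ) :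
    HasDerivAt (antiderivTower ψ y (m + 1)) (antiderivTower ψ y m x) x :=
  ((continuous_antiderivTower hψ y m).integral_hasStrictDerivAt 0 x).hasDerivAt.const_add _

theorem antiderivTower_succ_zero (ψ : ℝ → ℝ) (y : ℕ → ℝ) (m : ℕ) :
    antiderivTower ψ y (m + 1) 0 = y (m + 1) := by
  simp [antiderivTower]

theorem iteratedDeriv_antiderivTower {ψ : ℝ → ℝ} (hψ : Continuous ψ) (y : ℕ → ℝ) (i m : ℕ) :
    iteratedDeriv i (antiderivTower ψ y (m + i)) = antiderivTower ψ y m := by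
  induction i generalizing m with
  | zero => simp
  | succ i ih =>
    rw [iteratedDeriv_succ, show m + (i + 1) = m + 1 + i by ring, ih]
    exact funext fun x => (hasDerivAt_antiderivTower hψ y m x).deriv

theorem contDiff_antiderivTower {ψ : ℝ → ℝ} (hψ : Continuous ψ) (y : ℕ → ℝ) (m : ℕ) :
    ContDiff ℝ m (antiderivTower ψ y m) := by
  induction m with
  | zero => exact contDiff_zero.2 hψ
  | succ m ih =>
    have hd := hasDerivAt_antiderivTower hψ y m
    rw [Nat.cast_succ]
    refine contDiff_succ_iff_deriv.2 ⟨fun x => (hd x).differentiableAt,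
      fun h => absurd h (WithTop.natCast_ne_top m), ?_⟩
    rwa [show deriv (antiderivTower ψ y (m + 1)) = antiderivTower ψ y m from
      funext fun x => (hd x).deriv]

/-- Componentwise local uniform convergence gives one error sequence per compact set. -/
theorem exists_error_seq {f : ℕ → VecSeq d} {φ : ℝ → Fin (d + 1) → ℝ}
    (h : ∀ i, TendstoOnGrid (fun n α => f n α i) fun x => φ x i) {K : Set ℝ} (hK : IsCompact K) :
    ∃ ε : ℕ → ℝ, Tendsto ε atTop (𝓝 0) ∧ ∀ (n : ℕ) (i : Fin (d + 1)) (α : ℤ),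
      (α : ℝ) / 2 ^ n ∈ K → |f n α i - φ ((α : ℝ) / 2 ^ n) i| ≤ ε n := by
  obtain ⟨M, hM⟩ := hK.isBounded.exists_norm_le
  obtain ⟨Q, hQ⟩ := exists_nat_ge M
  set s : ℕ → Finset ℤ := fun n => Finset.Icc (-(Q * 2 ^ n : ℤ)) (Q * 2 ^ n)
  -- The error at level n is the largest deviation over the finitely many grid points in [-Q, Q] ⊇
  -- K, taken in `NNReal` so that the supremum has a bottom element.
  refine ⟨fun n => ((s n).sup fun α => ‖f n α - φ ((α : ℝ) / 2 ^ n)‖₊ : NNReal), ?_,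
    fun n i α hα => ?_⟩
  · rw [Metric.tendsto_atTop']
    intro ε hε
    have hall : ∀ᶠ n : ℕ in atTop, ∀ i, ∀ α : ℤ, |α| ≤ Q * 2 ^ n →
        |f n α i - φ ((α : ℝ) / 2 ^ n) i| ≤ ε / 2 :=
      eventually_all.2 fun i => h i Q (ε / 2) (by linarith)
    obtain ⟨N, hN⟩ := eventually_atTop.1 hall
    refine ⟨N, fun n hn => ?_⟩
    rw [Real.dist_eq, sub_zero, abs_of_nonneg (NNReal.coe_nonneg _)]
    refine lt_of_le_of_lt ?_ (half_lt_self hε)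
    rw [← Real.coe_toNNReal (ε / 2) (by linarith), NNReal.coe_le_coe]
    refine Finset.sup_le fun α hα => ?_
    rw [← NNReal.coe_le_coe, Real.coe_toNNReal _ (by linarith), coe_nnnorm]
    exact (pi_norm_le_iff_of_nonneg (by linarith)).2 fun i =>
      hN n hn.le i α (abs_le.2 (Finset.mem_Icc.1 hα))
  · have hαs : α ∈ s n := by
      have h1 := (hM _ hα).trans hQ
      rw [Real.norm_eq_abs, abs_div, abs_of_pos (by positivity : (0 : ℝ) < 2 ^ n),
        div_le_iff₀ (by positivity)] at h1
      exact Finset.mem_Icc.2 (abs_le.1 (by exact_mod_cast h1))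
    refine (norm_le_pi_norm (f n α - φ ((α : ℝ) / 2 ^ n)) i).trans ?_
    rw [← coe_nnnorm, NNReal.coe_le_coe]
    exact Finset.le_sup (f := fun α : ℤ => ‖f n α - φ ((α : ℝ) / 2 ^ n)‖₊) hαs

end HermiteSubdivision

/-! ### Downward induction on the components -/

theorem mainTheorem5 (d : ℕ) (A B : MatSeq d)
    (hA : (Function.support A).Finite) (hB : (Function.support B).Finite)
    (T : VecSeq d → VecSeq d) (hT : IsCompleteTaylorOp T)
    (hfactor : ∀ c : VecSeq d, T (subdivOp A c) = ((2 : ℝ) ^ d)⁻¹ • subdivOp B (T c))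
    (hzero : ∀ f₀ : VecSeq d, ∃ y : Fin (d + 1) → ℝ,
      Tendsto (fun n : ℕ => hermiteRefine A f₀ n 0) atTop (𝓝 y))
    (hcontr : IsContractive B)
    (hB21 : ∀ j : Fin d, symbol B 1 (Fin.last d) j.castSucc = 0)
    (hB22 : symbol B 1 (Fin.last d) (Fin.last d) = 1) :
    IsHermiteConvergent A d := by
  refine ⟨le_rfl, fun f₀ => ?_⟩
  obtain ⟨ψ, hψ, hlast⟩ :=
    exists_limit_last_component hA hB hT hfactor hcontr hB21 hB22 f₀
  obtain ⟨y, hy⟩ := hzero f₀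
  -- Level m of the tower is component d - m, so the values at zero are read in reverse. Only 1 ≤ m
  -- ≤ d is used, where `Fin.ofNat` does not wrap.
  set Y : ℕ → ℝ := fun m => y (Fin.rev (Fin.ofNat (d + 1) m)) with hY
  set φ : Fin (d + 1) → ℝ → ℝ := fun i => antiderivTower ψ Y (d - i) with hφ
  have hcont : ∀ i, Continuous (φ i) := fun i => continuous_antiderivTower hψ Y _
  -- Strong induction is needed because row i of T involves all components above i.
  have hlim : ∀ (m : ℕ) (i : Fin (d + 1)), d - (i : ℕ) = m →
      TendstoOnGrid (fun n α => hermiteRefine A f₀ n α i) (φ i) := by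
    intro m
    induction m using Nat.strong_induction_on with
    | _ m ih =>
      intro i hi
      rcases Nat.eq_zero_or_pos m with rfl | hm
      · have : i = Fin.last d := Fin.ext (by simp; omega)
        subst this
        simpa [hφ, antiderivTower] using hlast
      · obtain ⟨j', hj'⟩ : ∃ j' : Fin (d + 1), (j' : ℕ) = i + 1 := ⟨⟨i + 1, by omega⟩, rfl⟩
        have hsub : d - (i : ℕ) = d - (j' : ℕ) + 1 := by omega
        have hder : ∀ x, HasDerivAt (φ i) (φ j' x) x := by
          simp only [hφ, hsub]
          exact hasDerivAt_antiderivTower hψ Y _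
        have hval : φ i 0 = y i := by
          simp only [hφ, hsub, antiderivTower_succ_zero, hY]
          congr 1
          ext
          rw [Fin.val_rev, Fin.val_ofNat, Nat.mod_eq_of_lt (by omega)]
          omega
        refine TendstoOnGrid.of_hasDerivAt (hcont j') hder (ih _ (by omega) j' rfl)
          (tendstoOnGrid_divided_difference hA hB hT hfactor hcontr f₀ hj' hcont
            fun k hk => ih _ ?_ k rfl) ?_
        · rw [Fin.lt_def] at hk
          omega
        · rw [hval]
          exact (tendsto_pi_nhds.1 hy) i
  refine ⟨fun x i => φ i x, continuous_pi hcont, fun K hK =>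
    exists_error_seq (fun i => hlim _ i rfl) hK, contDiff_antiderivTower hψ Y d, fun i x => ?_⟩
  have := iteratedDeriv_antiderivTower hψ Y i (d - i)
  rw [Nat.sub_add_cancel (by omega)] at this
  exact congrFun this x
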